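/- Let $\mathcal C$ be a locally small extensive category: $\mathcal C$ has finite coproducts and pullbacks along coproduct coprojections, and for every commutative diagram $$\begin{array}{ccccc} A' & \to & C' & \leftarrow & B' \\ \downarrow & & \downarrow & & \downarrow \\ A & \to & C & \leftarrow & B \end{array}$$ whose bottom row is a coproduct diagram, the top row is a coproduct diagram if and only if both squares are pullbacks. For $X\in\mathcal C$ let $\mathrm{Sum}_{\mathcal C}(X)$ be the poset of isomorphism classes of coproduct coprojections $U\rightarrowtail X$; it is a Boolean algebra. An ultrafilter on $X$ is a Boolean algebra homomorphism $\mathrm{Sum}_{\mathcal C}(X)\to 2$, identified with the set $\mathcal U\subseteq\mathrm{Sum}_{\mathcal C}(X)$ of summands that it sends to $\top$. Let $\mathcal{UF}_{\mathcal C}$ be the category whose objects are the pairs $(X,\mathcal U)$ of an object $X$ of $\mathcal C$ and an ultrafilter $\mathcal U$ on $X$. A morphism $(X,\mathcal U)\to(Y,\mathcal V)$ is an equivalence class of morphisms $f\colon U\to Y$ of $\mathcal C$ defined on the domain of some $U\rightarrowtail X$ in $\mathcal U$ that are continuous, i.e. such that for all $V\in\mathrm{Sum}_{\mathcal C}(Y)$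 one has $V\in\mathcal V$ if and only if $(f^{-1}(V)\rightarrowtail U\rightarrowtail X)\in\mathcal U$; here $f\colon U\to Y$ and $f'\colon U'\to Y$ are equivalent if their restrictions to some $W\subseteq U\cap U'$ in $\mathcal U$ coincide. Composition is composition of partial maps. Then the category $\mathsf{FC}(\mathcal C,\mathbf{Set})$ of finite-coproduct-preserving functors $\mathcal C\to\mathbf{Set}$ (with all natural transformations) is equivalent to the functor category $[\mathcal{UF}_{\mathcal C},\mathbf{Set}]$. Under this equivalence the representable functor $\mathcal{UF}_{\mathcal C}((X,\mathcal U),-)$ corresponds, naturally in $(X,\mathcal U)\in\mathcal{UF}_{\mathcal C}^{\mathrm{op}}$, to the "ultrahom functor" $$\mathcal C(X,-)_{\mathcal U}=\operatorname{colim}_{U\in\mathcal U}\mathcal C(U,-)\colon\mathcal C\to\mathbf{Set},$$ the colimit being taken in $[\mathcal C,\mathbf{Set}]$ over the opposite of the poset $\mathcal U$; its value at $Y$ is the set of equivalence classes, as above, of not necessarily continuous morphisms $U\to Y$ with $U\in\mathcal U$, and a morphism $(X',\mathcal U')\to(X,\mathcal U)$ of $\mathcal{UF}_{\mathcal C}$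 acts on it by precomposition of partial maps. -/

import Mathlib

open CategoryTheory CategoryTheory.Limits Opposite

universe v u

namespace ExtensiveCat

noncomputable section

/-- `i : A ⟶ X` is a coproduct coprojection: it is one leg of a binary coproduct diagram
`A ⟶ X ⟵ B`. -/
def IsCoprojection {C : Type u} [Category.{v} C] {A X : C} (i : A ⟶ X) : Prop :=
  ∃ (B : C) (j : B ⟶ X), Nonempty (IsColimit (BinaryCofan.mk i j))

section Basic

variable {C : Type u} [Category.{v} C]

theorem exists_desc {A B X Z : C} {i : A ⟶ X} {j : B ⟶ X} (h : IsColimit (BinaryCofan.mk i j))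
    (f : A ⟶ Z) (g : B ⟶ Z) : ∃ d : X ⟶ Z, i ≫ d = f ∧ j ≫ d = g :=
  ⟨_, (BinaryCofan.IsColimit.desc' h f g).2⟩

theorem hom_ext_of_isColimit {A B X Z : C} {i : A ⟶ X} {j : B ⟶ X}
    (h : IsColimit (BinaryCofan.mk i j)) {f g : X ⟶ Z} (h₁ : i ≫ f = i ≫ g)
    (h₂ : j ≫ f = j ≫ g) : f = g :=
  BinaryCofan.IsColimit.hom_ext h h₁ h₂

theorem isColimit_of {A B X : C} {i : A ⟶ X} {j : B ⟶ X}
    (h : ∀ {Z : C} (f : A ⟶ Z) (g : B ⟶ Z), ∃ d : X ⟶ Z, i ≫ d = f ∧ j ≫ d = g)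
    (h' : ∀ {Z : C} (f g : X ⟶ Z), i ≫ f = i ≫ g → j ≫ f = j ≫ g → f = g) :
    Nonempty (IsColimit (BinaryCofan.mk i j)) := by
  choose d hd using @h
  exact ⟨BinaryCofan.isColimitMk (fun s => d s.inl s.inr) (fun s => (hd s.inl s.inr).1)
    (fun s => (hd s.inl s.inr).2) (fun s m h₁ h₂ => h' _ _ (h₁.trans (hd s.inl s.inr).1.symm)
      (h₂.trans (hd s.inl s.inr).2.symm))⟩

/-- The complementary coprojection to a coprojection. -/
theorem isCoprojection_symm {A B X : C} {i : A ⟶ X} {j : B ⟶ X}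
    (h : IsColimit (BinaryCofan.mk i j)) : IsCoprojection j :=
  ⟨A, i, ⟨BinaryCofan.isColimitFlip h⟩⟩

variable [FinitaryExtensive C]

theorem IsCoprojection.mono {A X : C} {i : A ⟶ X} (hi : IsCoprojection i) : Mono i := by
  obtain ⟨B, j, ⟨h⟩⟩ := hi
  exact FinitaryExtensive.mono_inl_of_isColimit h

theorem vanKampen_iff {X A B X' A' B' : C} {i : A ⟶ X} {j : B ⟶ X}
    (h : IsColimit (BinaryCofan.mk i j)) {i' : A' ⟶ X'} {j' : B' ⟶ X'}
    (a : A' ⟶ A) (b : B' ⟶ B) (f : X' ⟶ X) (ha : a ≫ i = i' ≫ f) (hb : b ≫ j = j' ≫ f) :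
    Nonempty (IsColimit (BinaryCofan.mk i' j')) ↔ IsPullback i' a f i ∧ IsPullback j' b f j :=
  (BinaryCofan.isVanKampen_iff _).1 (FinitaryExtensive.vanKampen _ h)
    (BinaryCofan.mk i' j') a b f ha hb

theorem IsCoprojection.hasPullback {A X Z : C} {i : A ⟶ X} (hi : IsCoprojection i)
    (f : Z ⟶ X) : HasPullback f i := by
  obtain ⟨B, j, ⟨h⟩⟩ := hi
  exact FinitaryPreExtensive.hasPullbacks_of_is_coproduct h ⟨WalkingPair.left⟩ f

theorem IsCoprojection.pullback_fst {A X Z : C} {i : A ⟶ X} (hi : IsCoprojection i)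
    (f : Z ⟶ X) [HasPullback f i] : IsCoprojection (pullback.fst f i) := by
  obtain ⟨B, j, ⟨h⟩⟩ := hi
  have := (isCoprojection_symm h).hasPullback f
  exact ⟨_, pullback.fst f j, (vanKampen_iff h (pullback.snd f i) (pullback.snd f j) f
    pullback.condition.symm pullback.condition.symm).2
      ⟨IsPullback.of_hasPullback f i, IsPullback.of_hasPullback f j⟩⟩

theorem IsCoprojection.comp {A U X : C} {a : A ⟶ U} {i : U ⟶ X} (ha : IsCoprojection a)
    (hi : IsCoprojection i) : IsCoprojection (a ≫ i) := by
  obtain ⟨B, b, ⟨h⟩⟩ := ha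
  obtain ⟨V, j, ⟨k⟩⟩ := hi
  refine ⟨B ⨿ V, coprod.desc (b ≫ i) j, isColimit_of (fun f g => ?_) (fun f g h₁ h₂ => ?_)⟩
  · obtain ⟨d, hd, hd'⟩ := exists_desc h f (coprod.inl ≫ g)
    obtain ⟨e, he, he'⟩ := exists_desc k d (coprod.inr ≫ g)
    refine ⟨e, by rw [Category.assoc, he, hd], ?_⟩
    ext
    · rw [coprod.inl_desc_assoc, Category.assoc, he, hd']
    · rw [coprod.inr_desc_assoc, he']
  · refine hom_ext_of_isColimit k (hom_ext_of_isColimit h ?_ ?_) ?_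
    · simpa using h₁
    · rw [← Category.assoc, ← Category.assoc, ← coprod.inl_desc (b ≫ i) j, Category.assoc, h₂,
        Category.assoc]
    · rw [← coprod.inr_desc (b ≫ i) j, Category.assoc, h₂, Category.assoc]

theorem isCoprojection_id (X : C) : IsCoprojection (𝟙 X) :=
  ⟨⊥_ C, initial.to X, ⟨BinaryCofan.isColimitMk (fun s => s.inl) (fun _ => Category.id_comp _)
    (fun _ => initialIsInitial.hom_ext _ _) (fun s m h _ => by rw [← h, Category.id_comp])⟩⟩

theorem isCoprojection_initial (X : C) : IsCoprojection (initial.to X) := by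
  obtain ⟨_, j, ⟨h⟩⟩ := isCoprojection_id X
  exact ⟨X, 𝟙 X, ⟨BinaryCofan.isColimitMk (fun s => s.inr)
    (fun _ => initialIsInitial.hom_ext _ _) (fun _ => Category.id_comp _)
    (fun s m _ h => by rw [← h, Category.id_comp])⟩⟩

/-- A coproduct summand is determined by a morphism `X ⟶ X ⨿ X`, hence the summands of an object
of a locally `v`-small extensive category form a `v`-small set. -/
instance small_summands (X : C) :
    Small.{v} {S : Subobject X // IsCoprojection S.arrow} := by
  choose B j h using fun S : {S : Subobject X // IsCoprojection S.arrow} => S.2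
  let φ : ∀ _ : {S : Subobject X // IsCoprojection S.arrow}, (X ⟶ X ⨿ X) := fun S =>
    (BinaryCofan.IsColimit.desc' (h S).some (S.1.arrow ≫ coprod.inl) (j S ≫ coprod.inr)).1
  have hφ : ∀ S, IsPullback S.1.arrow S.1.arrow (φ S) coprod.inl := fun S =>
    ((vanKampen_iff (coprodIsCoprod X X) S.1.arrow (j S) (φ S)
      (BinaryCofan.IsColimit.desc' (h S).some (S.1.arrow ≫ coprod.inl)
        (j S ≫ coprod.inr)).2.1.symm
      (BinaryCofan.IsColimit.desc' (h S).some (S.1.arrow ≫ coprod.inl)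
        (j S ≫ coprod.inr)).2.2.symm).1 ⟨(h S).some⟩).1
  have key : ∀ S T, φ S = φ T → S.1 ≤ T.1 := fun S T e =>
    Subobject.le_of_comm ((hφ T).lift S.1.arrow S.1.arrow (by rw [← e]; exact (hφ S).w))
      (IsPullback.lift_fst _ _ _ _)
  exact small_of_injective (f := φ)
    fun S T e => Subtype.ext (le_antisymm (key S T e) (key T S e.symm))

end Basic

/-- The coproduct summands of `X`: the isomorphism classes of coproduct coprojections with
codomain `X` (as a set in the universe of the hom-sets, via `Shrink`). -/
def Summand {C : Type u} [Category.{v} C] [FinitaryExtensive C] (X : C) : Type v :=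
  Shrink.{v} {S : Subobject X // IsCoprojection S.arrow}

namespace Summand

variable {C : Type u} [Category.{v} C] [FinitaryExtensive C] {X : C}

/-- The subobject of `X` underlying a summand. -/
def sub (S : Summand X) : Subobject X :=
  ((equivShrink {S : Subobject X // IsCoprojection S.arrow}).symm S).1

theorem sub_injective : Function.Injective (sub : Summand X → Subobject X) :=
  Subtype.val_injective.comp (equivShrink _).symm.injective

/-- The poset `Sum(X)` of summands of `X`, ordered as subobjects of `X`. -/
instance : PartialOrder (Summand X) := PartialOrder.lift sub sub_injective

/-- The domain of (a representative of) a summand. -/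
def dom (S : Summand X) : C := (S.sub : C)

/-- The inclusion of (a representative of) a summand. -/
def ι (S : Summand X) : S.dom ⟶ X := S.sub.arrow

instance (S : Summand X) : Mono S.ι := inferInstanceAs (Mono S.sub.arrow)

theorem isCoprojection (S : Summand X) : IsCoprojection S.ι :=
  ((equivShrink {S : Subobject X // IsCoprojection S.arrow}).symm S).2

theorem isCoprojection_mk_arrow {A : C} (i : A ⟶ X) [Mono i] (hi : IsCoprojection i) :
    IsCoprojection (Subobject.mk i).arrow := by
  obtain ⟨B, j, ⟨h⟩⟩ := hi
  let e := Subobject.underlyingIso i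
  have w : e.hom ≫ i = (Subobject.mk i).arrow := Subobject.underlyingIso_hom_comp_eq_mk i
  refine ⟨B, j, (vanKampen_iff h e.hom (𝟙 B) (𝟙 X) (by rw [w, Category.comp_id])
    (by rw [Category.comp_id, Category.id_comp])).2 ⟨?_, ?_⟩⟩
  · exact IsPullback.of_vert_isIso ⟨by rw [w, Category.comp_id]⟩
  · exact IsPullback.of_vert_isIso ⟨by rw [Category.comp_id, Category.id_comp]⟩

/-- The summand given by a coproduct coprojection. -/
def mk {A : C} (i : A ⟶ X) (hi : IsCoprojection i) : Summand X :=
  haveI := hi.mono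
  equivShrink _ ⟨Subobject.mk i, isCoprojection_mk_arrow i hi⟩

theorem sub_mk {A : C} (i : A ⟶ X) (hi : IsCoprojection i) :
    (mk i hi).sub = haveI := hi.mono; Subobject.mk i := by
  simp [mk, sub]

/-- A morphism `t : T ⟶ X` factors through the summand `S`. -/
def Factors (S : Summand X) {T : C} (t : T ⟶ X) : Prop := ∃ k : T ⟶ S.dom, k ≫ S.ι = t

theorem factors_mk {A : C} (i : A ⟶ X) (hi : IsCoprojection i) {T : C} (t : T ⟶ X) :
    (mk i hi).Factors t ↔ ∃ k : T ⟶ A, k ≫ i = t := by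
  have := hi.mono
  have h : (mk i hi).Factors t ↔ ∃ k : T ⟶ ((Subobject.mk i : Subobject X) : C),
      k ≫ (Subobject.mk i).arrow = t := by
    unfold Factors dom ι
    rw [sub_mk]
  rw [h]
  constructor
  · rintro ⟨k, rfl⟩
    exact ⟨k ≫ (Subobject.underlyingIso i).hom, by simp⟩
  · rintro ⟨k, rfl⟩
    exact ⟨k ≫ (Subobject.underlyingIso i).inv, by simp⟩

/-- The morphism witnessing an inequality of summands. -/
def ofLE {S T : Summand X} (h : S ≤ T) : S.dom ⟶ T.dom := Subobject.ofLE S.sub T.sub h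

@[simp]
theorem ofLE_ι {S T : Summand X} (h : S ≤ T) : ofLE h ≫ T.ι = S.ι := Subobject.ofLE_arrow h

@[simp]
theorem ofLE_ι_assoc {S T : Summand X} (h : S ≤ T) {Z : C} (g : X ⟶ Z) :
    ofLE h ≫ T.ι ≫ g = S.ι ≫ g := by
  rw [← Category.assoc, ofLE_ι]

theorem le_iff {S T : Summand X} : S ≤ T ↔ T.Factors S.ι :=
  ⟨fun h => ⟨ofLE h, ofLE_ι h⟩, fun ⟨k, hk⟩ => Subobject.le_of_comm k hk⟩

theorem factors_ι (S : Summand X) : S.Factors S.ι := ⟨𝟙 _, Category.id_comp _⟩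

theorem Factors.precomp {S : Summand X} {T T' : C} {t : T ⟶ X} (h : S.Factors t) (a : T' ⟶ T) :
    S.Factors (a ≫ t) := by
  obtain ⟨k, rfl⟩ := h
  exact ⟨a ≫ k, Category.assoc _ _ _⟩

theorem Factors.of_le {S S' : Summand X} (h : S ≤ S') {T : C} {t : T ⟶ X} (ht : S.Factors t) :
    S'.Factors t := by
  obtain ⟨k, rfl⟩ := ht
  exact (le_iff.1 h).precomp k

theorem le_of_factors {S S' : Summand X}
    (h : ∀ {T : C} (t : T ⟶ X), S.Factors t → S'.Factors t) : S ≤ S' :=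
  le_iff.2 (h _ S.factors_ι)

instance (V : Summand X) {Z : C} (f : Z ⟶ X) : HasPullback f V.ι := V.isCoprojection.hasPullback f

/-- The inverse image `f⁻¹(V)`, by pullback, of a summand `V` of `X` along `f : Z ⟶ X`. -/
def preimage {Z : C} (f : Z ⟶ X) (V : Summand X) : Summand Z :=
  mk (pullback.fst f V.ι) (V.isCoprojection.pullback_fst f)

theorem factors_preimage {Z : C} (f : Z ⟶ X) (V : Summand X) {T : C} (t : T ⟶ Z) :
    (preimage f V).Factors t ↔ V.Factors (t ≫ f) := by
  unfold preimage
  rw [factors_mk]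
  constructor
  · rintro ⟨k, rfl⟩
    exact ⟨k ≫ pullback.snd f V.ι, by simp [pullback.condition]⟩
  · rintro ⟨k, hk⟩
    exact ⟨pullback.lift t k hk.symm, pullback.lift_fst _ _ _⟩

/-- A summand `W` of (the domain of) a summand `S` of `X`, seen as the summand `W ↣ S ↣ X` of
`X`. -/
def push (S : Summand X) (W : Summand S.dom) : Summand X :=
  mk (W.ι ≫ S.ι) (W.isCoprojection.comp S.isCoprojection)

theorem factors_push (S : Summand X) (W : Summand S.dom) {T : C} (t : T ⟶ X) :
    (S.push W).Factors t ↔ ∃ k : T ⟶ S.dom, k ≫ S.ι = t ∧ W.Factors k := by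
  unfold push
  rw [factors_mk]
  constructor
  · rintro ⟨k, rfl⟩
    exact ⟨k ≫ W.ι, Category.assoc _ _ _, k, rfl⟩
  · rintro ⟨_, rfl, k, rfl⟩
    exact ⟨k, (Category.assoc _ _ _).symm⟩

instance : Top (Summand X) := ⟨mk (𝟙 X) (isCoprojection_id X)⟩

theorem factors_top {T : C} (t : T ⟶ X) : (⊤ : Summand X).Factors t :=
  (factors_mk _ _ _).2 ⟨t, Category.comp_id _⟩

instance : OrderTop (Summand X) where
  le_top _ := le_of_factors fun t _ => factors_top t

instance : Bot (Summand X) := ⟨mk (initial.to X) (isCoprojection_initial X)⟩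

theorem factors_bot {T : C} (t : T ⟶ X) : (⊥ : Summand X).Factors t ↔ Nonempty (IsInitial T) := by
  refine (factors_mk _ _ _).trans ⟨?_, ?_⟩
  · rintro ⟨k, -⟩
    have := initialIsInitial.isIso_to k
    exact ⟨initialIsInitial.ofIso (asIso k).symm⟩
  · rintro ⟨h⟩
    exact ⟨h.to _, h.hom_ext _ _⟩

instance : OrderBot (Summand X) where
  bot_le S := le_of_factors fun t ht => by
    obtain ⟨h⟩ := (factors_bot t).1 ht
    exact ⟨h.to _, h.hom_ext _ _⟩

/-- The intersection of two summands of `X`, by pullback. -/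
instance : Min (Summand X) := ⟨fun S T => S.push (preimage S.ι T)⟩

theorem factors_inf (S S' : Summand X) {T : C} (t : T ⟶ X) :
    (S ⊓ S').Factors t ↔ S.Factors t ∧ S'.Factors t := by
  refine (factors_push _ _ _).trans ⟨?_, ?_⟩
  · rintro ⟨k, rfl, h⟩
    exact ⟨⟨k, rfl⟩, (factors_preimage _ _ _).1 h⟩
  · rintro ⟨⟨k, rfl⟩, h⟩
    exact ⟨k, rfl, (factors_preimage _ _ _).2 h⟩

instance : SemilatticeInf (Summand X) where
  inf := (· ⊓ ·)
  inf_le_left _ _ := le_of_factors fun t ht => ((factors_inf _ _ t).1 ht).1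
  inf_le_right _ _ := le_of_factors fun t ht => ((factors_inf _ _ t).1 ht).2
  le_inf _ _ _ h h' := le_of_factors fun t ht =>
    (factors_inf _ _ t).2 ⟨ht.of_le h, ht.of_le h'⟩

theorem exists_compl (S : Summand X) :
    ∃ S' : Summand X, Nonempty (IsColimit (BinaryCofan.mk S.ι S'.ι)) := by
  obtain ⟨B, j, ⟨h⟩⟩ := S.isCoprojection
  have hj := isCoprojection_symm h
  obtain ⟨k, hk⟩ := (factors_mk j hj j).1 ⟨_, ((factors_mk j hj _).2
    ⟨𝟙 _, Category.id_comp _⟩).choose_spec⟩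
  obtain ⟨a, ha⟩ := (factors_mk j hj j).2 ⟨𝟙 _, Category.id_comp _⟩
  obtain ⟨b, hb⟩ := (factors_mk j hj _).1 (mk j hj).factors_ι
  have := hj.mono
  have : IsIso b := ⟨a, by rw [← cancel_mono (mk j hj).ι]; simp [ha, hb],
    by rw [← cancel_mono j]; simp [ha, hb]⟩
  refine ⟨mk j hj, (vanKampen_iff h (𝟙 _) b (𝟙 X) (by simp) (by simp [hb])).2 ⟨?_, ?_⟩⟩
  · exact IsPullback.of_vert_isIso ⟨by simp⟩
  · exact IsPullback.of_vert_isIso ⟨by simp [hb]⟩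

/-- The complementary summand. -/
instance : Compl (Summand X) := ⟨fun S => S.exists_compl.choose⟩

theorem isColimit_compl (S : Summand X) :
    Nonempty (IsColimit (BinaryCofan.mk S.ι Sᶜ.ι)) := S.exists_compl.choose_spec

theorem inf_compl_le_bot_iff (S T : Summand X) : S ⊓ Tᶜ ≤ ⊥ ↔ S ≤ T := by
  obtain ⟨h⟩ := T.isColimit_compl
  constructor
  · intro hST
    have hc := (vanKampen_iff h (pullback.snd S.ι T.ι) (pullback.snd S.ι Tᶜ.ι) S.ι
      pullback.condition.symm pullback.condition.symm).2
      ⟨IsPullback.of_hasPullback _ _, IsPullback.of_hasPullback _ _⟩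
    have hi : (S ⊓ Tᶜ).Factors (pullback.fst S.ι Tᶜ.ι ≫ S.ι) :=
      (factors_inf _ _ _).2 ⟨⟨_, rfl⟩, ⟨_, pullback.condition.symm⟩⟩
    obtain ⟨hi⟩ := (factors_bot _).1 (hi.of_le hST)
    obtain ⟨d, hd, -⟩ := exists_desc hc.some (pullback.snd S.ι T.ι) (hi.to _)
    refine le_iff.2 ⟨d, hom_ext_of_isColimit hc.some ?_ (hi.hom_ext _ _)⟩
    rw [← Category.assoc, hd, pullback.condition]
  · intro hST
    refine le_of_factors fun t ht => (factors_bot t).2 ?_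
    obtain ⟨h1, k, hk⟩ := (factors_inf _ _ _).1 ht
    obtain ⟨l, hl⟩ := h1.of_le hST
    have p := FinitaryExtensive.isPullback_initial_to_binaryCofan h
    have q := p.lift l k (hl.trans hk.symm)
    have := initialIsInitial.isIso_to q
    exact ⟨initialIsInitial.ofIso (asIso q).symm⟩

theorem inf_compl_self_le (a : Summand X) : a ⊓ aᶜ ≤ ⊥ := (inf_compl_le_bot_iff a a).2 le_rfl

theorem compl_compl' (a : Summand X) : aᶜᶜ = a := by
  have h : ∀ b : Summand X, bᶜᶜ ≤ b := fun b =>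
    (inf_compl_le_bot_iff _ _).1 (inf_comm bᶜᶜ bᶜ ▸ inf_compl_self_le bᶜ)
  exact le_antisymm (h a) ((inf_compl_le_bot_iff _ _).1
    ((inf_le_inf_left a (h aᶜ)).trans (inf_compl_self_le a)))

theorem le_compl_iff' (a b : Summand X) : a ≤ bᶜ ↔ a ⊓ b ≤ ⊥ := by
  rw [← inf_compl_le_bot_iff, compl_compl']

theorem le_sup_iff' (t a b : Summand X) : t ≤ (aᶜ ⊓ bᶜ)ᶜ ↔ t ⊓ aᶜ ≤ b := by
  rw [le_compl_iff', ← inf_assoc, inf_compl_le_bot_iff]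

/-- `Sum(X)` is a Boolean algebra. -/
instance : BooleanAlgebra (Summand X) where
  __ := (inferInstance : SemilatticeInf (Summand X))
  sup a b := (aᶜ ⊓ bᶜ)ᶜ
  le_sup_left a b := (le_sup_iff' _ _ _).2 ((inf_compl_self_le a).trans bot_le)
  le_sup_right a b := (le_sup_iff' _ _ _).2 inf_le_left
  sup_le a b c ha hb := by
    have anti : ∀ {x y : Summand X}, x ≤ y → yᶜ ≤ xᶜ := fun {x y} h =>
      (le_compl_iff' _ _).2
        ((inf_le_inf_left _ h).trans (inf_comm y yᶜ ▸ inf_compl_self_le y))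
    have := anti (le_inf (anti ha) (anti hb))
    rwa [compl_compl'] at this
  le_sup_inf x y z := (le_sup_iff' _ _ _).2 (le_inf
    ((le_sup_iff' _ _ _).1 inf_le_left) ((le_sup_iff' _ _ _).1 inf_le_right))
  le_top _ := le_top
  bot_le _ := bot_le
  inf_compl_le_bot := inf_compl_self_le
  top_le_sup_compl a := (le_sup_iff' _ _ _).2 inf_le_right

end Summand

/-- The set `βX` of ultrafilters on `X`: Boolean algebra homomorphisms from `Sum(X)` to the
two-element Boolean algebra of truth values. (A bounded lattice homomorphism between Boolean
algebras preserves complements.) The ultrafilter contains `U` when its value at `U` is true. -/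
abbrev Ult {C : Type u} [Category.{v} C] [FinitaryExtensive C] (X : C) : Type v :=
  BoundedLatticeHom (Summand X) Prop

/-- The objects of the category of ultrafilters: pairs of an object of `C` and an ultrafilter
on it. -/
structure UF (C : Type u) [Category.{v} C] [FinitaryExtensive C] : Type (max u v) where
  /-- The underlying object. -/
  pt : C
  /-- The ultrafilter. -/
  ult : Ult pt

variable {C : Type u} [Category.{v} C] [FinitaryExtensive C]

namespace UF

theorem mem_inf (P : UF C) {U V : Summand P.pt} (hU : P.ult U) (hV : P.ult V) :
    P.ult (U ⊓ V) := by
  rw [map_inf]; exact ⟨hU, hV⟩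

theorem mem_mono (P : UF C) {U V : Summand P.pt} (hU : P.ult U) (h : U ≤ V) : P.ult V :=
  OrderHomClass.mono P.ult h hU

theorem mem_top (P : UF C) : P.ult ⊤ := by
  rw [map_top]; trivial

end UF

/-- Partial maps `X ⇀ Y` defined on the domain of some summand of `X` in the given ultrafilter. -/
structure PartialMap (P : UF C) (Y : C) : Type v where
  /-- The summand on which the partial map is defined. -/
  supp : Summand P.pt
  /-- It belongs to the ultrafilter. -/
  mem : P.ult supp
  /-- The map itself. -/
  hom : supp.dom ⟶ Y

namespace PartialMap

variable {P Q R : UF C} {Y Z : C}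

/-- The inverse image of a summand `V` of `Y` along a partial map `f : U ⟶ Y`, as the summand
`f⁻¹(V) ↣ U ↣ X` of `X`. -/
def preimage (f : PartialMap P Y) (V : Summand Y) : Summand P.pt :=
  f.supp.push (Summand.preimage f.hom V)

/-- A partial map is continuous with respect to an ultrafilter `𝒱` on its codomain when
`V ∈ 𝒱` iff `f⁻¹(V)` is in the ultrafilter on its domain. -/
def Continuous (f : PartialMap P Q.pt) : Prop :=
  ∀ V : Summand Q.pt, Q.ult V ↔ P.ult (f.preimage V)

/-- Two partial maps are equivalent if they coincide on some member of the ultrafilter contained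
in both of their supports. -/
def Eqv (f g : PartialMap P Y) : Prop :=
  ∃ (W : Summand P.pt) (_ : P.ult W) (hf : W ≤ f.supp) (hg : W ≤ g.supp),
    Summand.ofLE hf ≫ f.hom = Summand.ofLE hg ≫ g.hom

theorem restrict_eq {S T : Summand P.pt} {f : S.dom ⟶ Y} {g : T.dom ⟶ Y} {W W' : Summand P.pt}
    (hS : W ≤ S) (hT : W ≤ T) (h : Summand.ofLE hS ≫ f = Summand.ofLE hT ≫ g) (hW : W' ≤ W) :
    Summand.ofLE (hW.trans hS) ≫ f = Summand.ofLE (hW.trans hT) ≫ g := by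
  have e : ∀ {U : Summand P.pt} (hU : W ≤ U),
      Summand.ofLE (hW.trans hU) = Summand.ofLE hW ≫ Summand.ofLE hU := fun hU => by
    rw [← cancel_mono (Summand.ι _)]; simp
  rw [e hS, e hT, Category.assoc, h, Category.assoc]

/-- Equality of germs. -/
instance setoid (P : UF C) (Y : C) : Setoid (PartialMap P Y) where
  r := Eqv
  iseqv :=
    { refl := fun f => ⟨f.supp, f.mem, le_rfl, le_rfl, rfl⟩
      symm := fun ⟨W, hW, h1, h2, h⟩ => ⟨W, hW, h2, h1, h.symm⟩
      trans := fun ⟨W, hW, h1, h2, h⟩ ⟨W', hW', h1', h2', h'⟩ =>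
        ⟨W ⊓ W', P.mem_inf hW hW', inf_le_left.trans h1, inf_le_right.trans h2',
          (restrict_eq h1 h2 h inf_le_left).trans (restrict_eq h1' h2' h' inf_le_right)⟩ }

/-- A criterion for equivalence: the two partial maps agree after composing with some morphism
representing a member of the ultrafilter. -/
theorem eqv_of {f g : PartialMap P Y} (W : Summand P.pt) (hW : P.ult W)
    (a : W.dom ⟶ f.supp.dom) (b : W.dom ⟶ g.supp.dom) (ha : a ≫ f.supp.ι = W.ι)
    (hb : b ≫ g.supp.ι = W.ι) (h : a ≫ f.hom = b ≫ g.hom) : Eqv f g := by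
  have hf : W ≤ f.supp := Summand.le_iff.2 ⟨a, ha⟩
  have hg : W ≤ g.supp := Summand.le_iff.2 ⟨b, hb⟩
  refine ⟨W, hW, hf, hg, ?_⟩
  have e1 : Summand.ofLE hf = a := by rw [← cancel_mono f.supp.ι, ha, Summand.ofLE_ι]
  have e2 : Summand.ofLE hg = b := by rw [← cancel_mono g.supp.ι, hb, Summand.ofLE_ι]
  rw [e1, e2, h]

theorem factors_preimage (f : PartialMap P Y) (V : Summand Y) {T : C} (t : T ⟶ P.pt) :
    (f.preimage V).Factors t ↔
      ∃ k : T ⟶ f.supp.dom, k ≫ f.supp.ι = t ∧ V.Factors (k ≫ f.hom) := by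
  simp only [preimage, Summand.factors_push, Summand.factors_preimage]

theorem exists_preimage (f : PartialMap P Y) (V : Summand Y) :
    ∃ (k : (f.preimage V).dom ⟶ f.supp.dom) (l : (f.preimage V).dom ⟶ V.dom),
      k ≫ f.supp.ι = (f.preimage V).ι ∧ l ≫ V.ι = k ≫ f.hom := by
  obtain ⟨k, hk, l, hl⟩ := (f.factors_preimage V _).1 (f.preimage V).factors_ι
  exact ⟨k, l, hk, hl⟩

/-- The restriction `f⁻¹(V) ⟶ V` of a partial map `f`. -/
def restrict (f : PartialMap P Y) (V : Summand Y) : (f.preimage V).dom ⟶ V.dom :=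
  (f.exists_preimage V).choose_spec.choose

theorem restrict_spec (f : PartialMap P Y) (V : Summand Y) :
    ∃ k : (f.preimage V).dom ⟶ f.supp.dom, k ≫ f.supp.ι = (f.preimage V).ι ∧
      f.restrict V ≫ V.ι = k ≫ f.hom :=
  ⟨_, (f.exists_preimage V).choose_spec.choose_spec⟩

/-- The identity, as an everywhere defined partial map. -/
protected def id (P : UF C) : PartialMap P P.pt := ⟨⊤, P.mem_top, Summand.ι ⊤⟩

theorem id_continuous (P : UF C) : Continuous (Q := P) (PartialMap.id P) := by
  intro V
  have : (PartialMap.id P).preimage V = V := by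
    refine le_antisymm (Summand.le_of_factors fun t ht => ?_) (Summand.le_of_factors fun t ht => ?_)
    · obtain ⟨k, rfl, h⟩ := (factors_preimage _ _ _).1 ht
      exact h
    · obtain ⟨k, hk⟩ := Summand.factors_top t
      exact (factors_preimage _ _ _).2 ⟨k, hk, by simpa [PartialMap.id, hk] using ht⟩
  rw [this]

/-- Composition of partial maps: `g ∘ f` is defined on `f⁻¹(V)`, where `g` is defined on `V`. -/
def comp (f : PartialMap P Q.pt) (hf : f.Continuous) (g : PartialMap Q Z) : PartialMap P Z :=
  ⟨f.preimage g.supp, (hf _).1 g.mem, f.restrict g.supp ≫ g.hom⟩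

theorem preimage_comp (f : PartialMap P Q.pt) (hf : f.Continuous) (g : PartialMap Q Z)
    (V : Summand Z) : (f.comp hf g).preimage V = f.preimage (g.preimage V) := by
  obtain ⟨k, hk, hl⟩ := f.restrict_spec g.supp
  refine le_antisymm (Summand.le_of_factors fun t ht => ?_) (Summand.le_of_factors fun t ht => ?_)
  · obtain ⟨a, rfl, h⟩ : ∃ a : _ ⟶ (f.preimage g.supp).dom, a ≫ (f.preimage g.supp).ι = t ∧
        V.Factors (a ≫ f.restrict g.supp ≫ g.hom) := (factors_preimage _ _ _).1 ht
    refine (factors_preimage _ _ _).2 ⟨a ≫ k, by rw [Category.assoc, hk], ?_⟩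
    refine (factors_preimage _ _ _).2 ⟨a ≫ f.restrict g.supp, ?_, ?_⟩
    · rw [Category.assoc, hl, Category.assoc]
    · rw [Category.assoc]; exact h
  · obtain ⟨a, rfl, h⟩ := (factors_preimage _ _ _).1 ht
    obtain ⟨b, hb, h⟩ := (factors_preimage _ _ _).1 h
    obtain ⟨c, hc⟩ : (f.preimage g.supp).Factors (a ≫ f.supp.ι) :=
      (factors_preimage _ _ _).2 ⟨a, rfl, b, hb⟩
    refine (factors_preimage _ _ _).2 ⟨c, hc, ?_⟩
    have e1 : c ≫ k = a := by
      rw [← cancel_mono f.supp.ι, Category.assoc, hk, hc]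
    have e2 : c ≫ f.restrict g.supp = b := by
      rw [← cancel_mono g.supp.ι, Category.assoc, hl, ← Category.assoc, e1, hb]
    change V.Factors (c ≫ f.restrict g.supp ≫ g.hom)
    rw [← Category.assoc, e2]
    exact h

theorem comp_continuous (f : PartialMap P Q.pt) (hf : f.Continuous) (g : PartialMap Q R.pt)
    (hg : g.Continuous) : Continuous (Q := R) (f.comp hf g) := fun V => by
  rw [preimage_comp, hg V, hf (g.preimage V)]

theorem comp_eqv {f f' : PartialMap P Q.pt} (hf : f.Continuous) (hf' : f'.Continuous)
    {g g' : PartialMap Q Z} (h : Eqv f f') (h' : Eqv g g') :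
    Eqv (f.comp hf g) (f'.comp hf' g') := by
  obtain ⟨W, hW, h1, h2, h⟩ := h
  obtain ⟨V, hV, h1', h2', h'⟩ := h'
  -- work on `W ∩ f⁻¹(V)`
  obtain ⟨T, hT, hTW, hTV⟩ : ∃ T, P.ult T ∧ T ≤ W ∧ T ≤ f.preimage V :=
    ⟨W ⊓ f.preimage V, P.mem_inf hW ((hf V).1 hV), inf_le_left, inf_le_right⟩
  obtain ⟨a, ha⟩ := Summand.le_iff.1 hTW
  obtain ⟨b, hb⟩ := Summand.le_iff.1 hTV
  obtain ⟨k, hk, hl⟩ := f.restrict_spec V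
  obtain ⟨m, hm, hn⟩ := f.restrict_spec g.supp
  obtain ⟨m', hm', hn'⟩ := f'.restrict_spec g'.supp
  have e1 : a ≫ Summand.ofLE h1 = b ≫ k := by
    rw [← cancel_mono f.supp.ι]; simp [ha, hk, hb]
  have e2 : b ≫ f.restrict V ≫ V.ι = a ≫ Summand.ofLE h1 ≫ f.hom := by
    rw [hl, ← Category.assoc, ← e1, Category.assoc]
  obtain ⟨c, hc⟩ : (f.preimage g.supp).Factors T.ι :=
    (factors_preimage _ _ _).2 ⟨a ≫ Summand.ofLE h1, by simp [ha],
      b ≫ f.restrict V ≫ Summand.ofLE h1', by simp [e2]⟩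
  obtain ⟨c', hc'⟩ : (f'.preimage g'.supp).Factors T.ι :=
    (factors_preimage _ _ _).2 ⟨a ≫ Summand.ofLE h2, by simp [ha],
      b ≫ f.restrict V ≫ Summand.ofLE h2', by simp [e2, h]⟩
  refine eqv_of T hT c c' hc hc' ?_
  have d : c ≫ f.restrict g.supp = b ≫ f.restrict V ≫ Summand.ofLE h1' := by
    have : c ≫ m = a ≫ Summand.ofLE h1 := by
      rw [← cancel_mono f.supp.ι]; simp [ha, hm, hc]
    rw [← cancel_mono g.supp.ι, Category.assoc, hn, ← Category.assoc, this]
    simp [e2]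
  have d' : c' ≫ f'.restrict g'.supp = b ≫ f.restrict V ≫ Summand.ofLE h2' := by
    have : c' ≫ m' = a ≫ Summand.ofLE h2 := by
      rw [← cancel_mono f'.supp.ι]; simp [ha, hm', hc']
    rw [← cancel_mono g'.supp.ι, Category.assoc, hn', ← Category.assoc, this]
    simp [e2, h]
  change c ≫ f.restrict g.supp ≫ g.hom = c' ≫ f'.restrict g'.supp ≫ g'.hom
  rw [← Category.assoc, d, ← Category.assoc c', d']
  simp only [Category.assoc, h']

theorem id_comp_eqv (g : PartialMap P Z) :
    Eqv ((PartialMap.id P).comp (id_continuous P) g) g := by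
  obtain ⟨m, hm, hn⟩ := (PartialMap.id P).restrict_spec g.supp
  refine eqv_of _ ((PartialMap.id P).comp (id_continuous P) g).mem (𝟙 _)
    ((PartialMap.id P).restrict g.supp) (Category.id_comp _) (hn.trans hm) (Category.id_comp _)

theorem comp_id_eqv (f : PartialMap P Q.pt) (hf : f.Continuous) :
    Eqv (f.comp hf (PartialMap.id Q)) f := by
  obtain ⟨m, hm, hn⟩ := f.restrict_spec (⊤ : Summand Q.pt)
  exact eqv_of _ (f.comp hf (PartialMap.id Q)).mem (𝟙 _) m (Category.id_comp _) hm
    ((Category.id_comp _).trans hn)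

theorem assoc_eqv (f : PartialMap P Q.pt) (hf : f.Continuous) (g : PartialMap Q R.pt)
    (hg : g.Continuous) (h : PartialMap R Z) :
    Eqv ((f.comp hf g).comp (comp_continuous f hf g hg) h) (f.comp hf (g.comp hg h)) := by
  obtain ⟨a, ha, ha'⟩ : ∃ a : ((f.comp hf g).preimage h.supp).dom ⟶ (f.preimage g.supp).dom,
      a ≫ (f.preimage g.supp).ι = ((f.comp hf g).preimage h.supp).ι ∧
      (f.comp hf g).restrict h.supp ≫ h.supp.ι = a ≫ f.restrict g.supp ≫ g.hom :=
    (f.comp hf g).restrict_spec h.supp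
  obtain ⟨b, hb, hb'⟩ := f.restrict_spec g.supp
  obtain ⟨c, hc, hc'⟩ := f.restrict_spec (g.preimage h.supp)
  obtain ⟨d, hd, hd'⟩ := g.restrict_spec h.supp
  have e : ((f.comp hf g).preimage h.supp) = f.preimage (g.preimage h.supp) :=
    preimage_comp f hf g h.supp
  obtain ⟨s, hs⟩ := Summand.le_iff.1 e.le
  refine eqv_of _ ((f.comp hf g).comp (comp_continuous f hf g hg) h).mem (𝟙 _) s
    (Category.id_comp _) hs ?_
  change 𝟙 _ ≫ (f.comp hf g).restrict h.supp ≫ h.hom =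
    s ≫ f.restrict (g.preimage h.supp) ≫ g.restrict h.supp ≫ h.hom
  have e1 : a ≫ b = s ≫ c := by
    rw [← cancel_mono f.supp.ι, Category.assoc, Category.assoc, hb, hc, hs, ha]
  have e2 : a ≫ f.restrict g.supp = s ≫ f.restrict (g.preimage h.supp) ≫ d := by
    rw [← cancel_mono g.supp.ι]
    simp only [Category.assoc]
    rw [hb', hd, hc', ← Category.assoc, e1, Category.assoc]
  have e3 : (f.comp hf g).restrict h.supp =
      s ≫ f.restrict (g.preimage h.supp) ≫ g.restrict h.supp := by
    rw [← cancel_mono h.supp.ι, ha']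
    simp only [Category.assoc]
    rw [hd', ← Category.assoc a, e2]
    simp only [Category.assoc]
  rw [e3, Category.id_comp]
  simp only [Category.assoc]

/-- Postcomposition of a partial map with an everywhere defined morphism. -/
def postcomp (f : PartialMap P Y) (a : Y ⟶ Z) : PartialMap P Z := ⟨f.supp, f.mem, f.hom ≫ a⟩

theorem postcomp_eqv {f g : PartialMap P Y} (h : Eqv f g) (a : Y ⟶ Z) :
    Eqv (f.postcomp a) (g.postcomp a) := by
  obtain ⟨W, hW, h1, h2, h⟩ := h
  exact ⟨W, hW, h1, h2, by simp only [postcomp, ← Category.assoc]; rw [h]⟩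

end PartialMap

/-- The category of ultrafilters: a morphism `(X, 𝒰) ⟶ (Y, 𝒱)` is an equivalence class of
continuous partial maps `X ⇀ Y` defined on a member of `𝒰`, two of them being equivalent when
they coincide on a member of `𝒰`. -/
instance : Category.{v} (UF C) where
  Hom P Q := Quotient ((PartialMap.setoid P Q.pt).comap
    (Subtype.val : {f : PartialMap P Q.pt // f.Continuous} → PartialMap P Q.pt))
  id P := Quotient.mk _ ⟨PartialMap.id P, PartialMap.id_continuous P⟩
  comp := fun {P Q R} => Quotient.map₂
    (fun f g => ⟨f.1.comp f.2 g.1, PartialMap.comp_continuous f.1 f.2 g.1 g.2⟩)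
    (fun f f' h _ _ h' => PartialMap.comp_eqv f.2 f'.2 h h')
  id_comp := by
    rintro P Q ⟨f⟩
    exact Quotient.sound (PartialMap.id_comp_eqv f.1)
  comp_id := by
    rintro P Q ⟨f⟩
    exact Quotient.sound (PartialMap.comp_id_eqv f.1 f.2)
  assoc := by
    rintro P Q R S ⟨f⟩ ⟨g⟩ ⟨h⟩
    exact Quotient.sound (PartialMap.assoc_eqv f.1 f.2 g.1 g.2 h.1)

/-- Germs at `(X, 𝒰)` of partial maps `X ⇀ Y`, with no continuity condition. -/
def Germ (P : UF C) (Y : C) : Type v := Quotient (PartialMap.setoid P Y)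

/-- The ultrahom functor at `(X, 𝒰)`: it sends `Y` to the set of germs of partial maps
`X ⇀ Y`, and acts by postcomposition. -/
def ultrahom (P : UF C) : C ⥤ Type v where
  obj Y := Germ P Y
  map a := ↾(Quotient.map (fun f => f.postcomp a) fun _ _ h => PartialMap.postcomp_eqv h a)
  map_id Y := by
    ext ⟨f⟩
    exact congrArg (Quotient.mk _) (by simp [PartialMap.postcomp])
  map_comp a b := by
    ext ⟨f⟩
    exact congrArg (Quotient.mk _) (by simp [PartialMap.postcomp])

/-- The functoriality of the ultrahom functor in `(X, 𝒰)`, by precomposition with germs of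
continuous partial maps. -/
def ultrahomFunctor (C : Type u) [Category.{v} C] [FinitaryExtensive C] :
    (UF C)ᵒᵖ ⥤ C ⥤ Type v where
  obj P := ultrahom P.unop
  map {P Q} a :=
    { app := fun Y => ↾(fun g : Germ P.unop Y => (Quotient.map₂
        (fun (f : {f : PartialMap Q.unop P.unop.pt // f.Continuous}) g => f.1.comp f.2 g)
        (fun f f' h _ _ h' => PartialMap.comp_eqv f.2 f'.2 h h') a.unop g : Germ Q.unop Y))
      naturality := by
        intro Y Z b
        obtain ⟨⟨f⟩⟩ := a
        ext ⟨g⟩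
        exact congrArg (Quotient.mk _) (by simp [PartialMap.postcomp, PartialMap.comp]) }
  map_id P := by
    ext Y ⟨g⟩
    exact Quotient.sound (PartialMap.id_comp_eqv g)
  map_comp := by
    rintro P Q R ⟨⟨f⟩⟩ ⟨⟨g⟩⟩
    ext Y ⟨h⟩
    exact Quotient.sound (PartialMap.assoc_eqv g.1 g.2 f.1 f.2 h)

/-- The members of the ultrafilter `𝒰`, as a subposet of `Sum(X)`. -/
abbrev UF.Members (P : UF C) : Type v := {U : Summand P.pt // P.ult U}

/-- The functor sending a member of `𝒰` to its domain, and an inclusion `U ⊆ V` to the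
corresponding morphism `U ⟶ V`. -/
def UF.domFunctor (P : UF C) : P.Members ⥤ C where
  obj U := U.1.dom
  map a := Summand.ofLE (leOfHom a)
  map_id U := by rw [← cancel_mono U.1.ι]; simp
  map_comp {U V W} a b := by rw [← cancel_mono W.1.ι]; simp

/-- The diagram of hom-functors `C(U, –)`, indexed by the opposite of the poset `𝒰`. -/
def UF.homDiagram (P : UF C) : P.Membersᵒᵖ ⥤ C ⥤ Type v := P.domFunctor.op ⋙ coyoneda

/-- The cocone under the diagram of the `C(U, –)` with vertex the ultrahom functor, sending a
morphism `U ⟶ Y` to its germ. -/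
def ultrahomCocone (P : UF C) : Cocone P.homDiagram where
  pt := ultrahom P
  ι :=
    { app := fun U =>
        { app := fun Y => ↾(fun f : U.unop.1.dom ⟶ Y =>
            (Quotient.mk _ ⟨U.unop.1, U.unop.2, f⟩ : Germ P Y))
          naturality := by
            intro Y Z b
            ext f
            rfl }
      naturality := by
        intro U V a
        ext Y f
        refine Quotient.sound (PartialMap.eqv_of V.unop.1 V.unop.2 (𝟙 _) (P.domFunctor.map a.unop)
          (Category.id_comp _) (Summand.ofLE_ι _) (Category.id_comp _)) }

/-- The category of finite-coproduct-preserving functors from `C` to sets, as a full subcategory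
of the category of all functors. -/
abbrev FC (C : Type u) [Category.{v} C] : ObjectProperty (C ⥤ Type v) :=
  fun F => PreservesFiniteCoproducts F

end

end ExtensiveCat

namespace ExtensiveCat

noncomputable section

namespace Summand

variable {C : Type u} [Category.{v} C] [FinitaryExtensive C] {X : C}

theorem ext_factors {S S' : Summand X}
    (h : ∀ {T : C} (t : T ⟶ X), S.Factors t ↔ S'.Factors t) : S = S' :=
  le_antisymm (le_of_factors fun t => (h t).1) (le_of_factors fun t => (h t).2)

theorem isCompl_mk {A B : C} {i : A ⟶ X} {j : B ⟶ X} (h : IsColimit (BinaryCofan.mk i j))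
    (hi : IsCoprojection i) (hj : IsCoprojection j) : IsCompl (mk i hi) (mk j hj) := by
  constructor
  · rw [disjoint_iff_inf_le]
    refine le_of_factors fun t ht => (factors_bot t).2 ?_
    obtain ⟨h₁, h₂⟩ := (factors_inf _ _ _).1 ht
    obtain ⟨k, hk⟩ := (factors_mk _ _ _).1 h₁
    obtain ⟨l, hl⟩ := (factors_mk _ _ _).1 h₂
    have p := FinitaryExtensive.isPullback_initial_to_binaryCofan h
    have := initialIsInitial.isIso_to (p.lift k l (hk.trans hl.symm))
    exact ⟨initialIsInitial.ofIso (asIso (p.lift k l (hk.trans hl.symm))).symm⟩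
  · rw [codisjoint_iff_le_sup]
    obtain ⟨a, ha⟩ : (mk i hi ⊔ mk j hj).Factors i :=
      Factors.of_le le_sup_left ((factors_mk i hi i).2 ⟨𝟙 _, Category.id_comp _⟩)
    obtain ⟨b, hb⟩ : (mk i hi ⊔ mk j hj).Factors j :=
      Factors.of_le le_sup_right ((factors_mk j hj j).2 ⟨𝟙 _, Category.id_comp _⟩)
    obtain ⟨d, hd, hd'⟩ := exists_desc h a b
    have : d ≫ (mk i hi ⊔ mk j hj).ι = 𝟙 X := hom_ext_of_isColimit h
      (by rw [← Category.assoc, hd, ha, Category.comp_id])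
      (by rw [← Category.assoc, hd', hb, Category.comp_id])
    refine le_of_factors fun t _ => ⟨t ≫ d, ?_⟩
    rw [Category.assoc, this, Category.comp_id]

theorem preimage_top {Z : C} (f : Z ⟶ X) : preimage f ⊤ = ⊤ :=
  ext_factors fun t => by simp only [factors_preimage, factors_top]

theorem preimage_bot {Z : C} (f : Z ⟶ X) : preimage f ⊥ = ⊥ :=
  ext_factors fun t => by simp only [factors_preimage, factors_bot]

theorem preimage_inf {Z : C} (f : Z ⟶ X) (V W : Summand X) :
    preimage f (V ⊓ W) = preimage f V ⊓ preimage f W :=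
  ext_factors fun t => by simp only [factors_preimage, factors_inf]

theorem isCompl_preimage {Z : C} (f : Z ⟶ X) (V : Summand X) :
    IsCompl (preimage f V) (preimage f Vᶜ) := by
  obtain ⟨h⟩ := V.isColimit_compl
  obtain ⟨k⟩ := (vanKampen_iff h (pullback.snd f V.ι) (pullback.snd f Vᶜ.ι) f
    pullback.condition.symm pullback.condition.symm).2
      ⟨IsPullback.of_hasPullback _ _, IsPullback.of_hasPullback _ _⟩
  exact isCompl_mk k _ _

theorem preimage_compl {Z : C} (f : Z ⟶ X) (V : Summand X) :
    preimage f Vᶜ = (preimage f V)ᶜ :=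
  (isCompl_preimage f V).compl_eq.symm

theorem preimage_sup {Z : C} (f : Z ⟶ X) (V W : Summand X) :
    preimage f (V ⊔ W) = preimage f V ⊔ preimage f W := by
  rw [← compl_inj_iff, ← preimage_compl, compl_sup, compl_sup, preimage_inf, preimage_compl,
    preimage_compl]

theorem push_le_iff (S : Summand X) (W : Summand S.dom) (V : Summand X) :
    S.push W ≤ V ↔ W ≤ preimage S.ι V := by
  constructor
  · refine fun h => le_of_factors fun t ht => (factors_preimage _ _ _).2 ?_
    exact Factors.of_le h ((factors_push _ _ _).2 ⟨t, rfl, ht⟩)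
  · refine fun h => le_of_factors fun t ht => ?_
    obtain ⟨k, rfl, hk⟩ := (factors_push _ _ _).1 ht
    exact (factors_preimage _ _ _).1 (hk.of_le h)

theorem gc_push_preimage (S : Summand X) : GaloisConnection S.push (preimage S.ι) :=
  S.push_le_iff

theorem push_top (S : Summand X) : S.push ⊤ = S :=
  ext_factors fun _ => by simp only [factors_push, factors_top, and_true]; rfl

theorem push_inf (S : Summand X) (V W : Summand S.dom) :
    S.push (V ⊓ W) = S.push V ⊓ S.push W :=
  ext_factors fun t => by
    simp only [factors_inf, factors_push]
    constructor
    · rintro ⟨k, rfl, hV, hW⟩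
      exact ⟨⟨k, rfl, hV⟩, ⟨k, rfl, hW⟩⟩
    · rintro ⟨⟨k, rfl, hV⟩, ⟨l, hl, hW⟩⟩
      obtain rfl := (cancel_mono S.ι).1 hl
      exact ⟨l, rfl, hV, hW⟩

theorem mk_ι (S : Summand X) : mk S.ι S.isCoprojection = S :=
  ext_factors fun _ => factors_mk _ _ _

/-- A coprojection is isomorphic to the summand it represents. -/
theorem exists_iso_mk {A : C} (i : A ⟶ X) (hi : IsCoprojection i) :
    ∃ e : (mk i hi).dom ≅ A, e.hom ≫ i = (mk i hi).ι := by
  have := hi.mono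
  obtain ⟨a, ha⟩ := (factors_mk i hi i).2 ⟨𝟙 _, Category.id_comp _⟩
  obtain ⟨b, hb⟩ := (factors_mk i hi _).1 (mk i hi).factors_ι
  exact ⟨⟨b, a, by rw [← cancel_mono (mk i hi).ι]; simp [ha, hb],
    by rw [← cancel_mono i]; simp [ha, hb]⟩, hb⟩

end Summand

variable {C : Type u} [Category.{v} C] [FinitaryExtensive C]

section Ultrafilters

variable {X : C}

theorem Ult.compl_iff (𝒰 : Ult X) (U : Summand X) : 𝒰 Uᶜ ↔ ¬ 𝒰 U := by
  rw [map_compl' 𝒰 U]; rfl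

theorem Ult.ext_of_le {𝒰 𝒱 : Ult X} (h : ∀ U, 𝒰 U → 𝒱 U) : 𝒰 = 𝒱 := by
  ext U
  refine ⟨h U, fun hU => by_contra fun hn => ?_⟩
  exact (Ult.compl_iff 𝒱 U).1 (h _ ((Ult.compl_iff 𝒰 U).2 hn)) hU

/-- A proper filter of summands containing each summand or its complement is an ultrafilter. -/
def Ult.ofPrime (p : Summand X → Prop) (top : p ⊤) (inf : ∀ U V, p (U ⊓ V) ↔ p U ∧ p V)
    (compl : ∀ U, p Uᶜ ↔ ¬ p U) : Ult X where
  toFun := p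
  map_sup' U V := by
    have : p (U ⊔ V) ↔ p U ∨ p V := by
      rw [← not_iff_not, ← compl, compl_sup, inf, compl, compl, not_or]
    exact propext this
  map_inf' U V := propext (inf U V)
  map_top' := propext (iff_true_intro top)
  map_bot' := by
    have : ¬ p ⊥ := by rw [← compl, compl_bot]; exact top
    exact propext (iff_false_intro this)

end Ultrafilters

namespace PartialMap

variable {P Q : UF C} {Y Z : C}

theorem preimage_mem_of_eqv {f g : PartialMap P Y} (h : Eqv f g) (V : Summand Y)
    (hf : P.ult (f.preimage V)) : P.ult (g.preimage V) := by
  obtain ⟨W, hW, h₁, h₂, h⟩ := h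
  refine P.mem_mono (P.mem_inf hW hf) (Summand.le_of_factors fun t ht => ?_)
  obtain ⟨⟨k, rfl⟩, ht⟩ := (Summand.factors_inf _ _ _).1 ht
  obtain ⟨l, hl, hV⟩ := (factors_preimage _ _ _).1 ht
  have e : l = k ≫ Summand.ofLE h₁ := by
    rw [← cancel_mono f.supp.ι, hl, Category.assoc, Summand.ofLE_ι]
  refine (factors_preimage _ _ _).2 ⟨k ≫ Summand.ofLE h₂, by simp, ?_⟩
  rwa [Category.assoc, ← h, ← Category.assoc, ← e]

/-- The image of the ultrafilter of `P` under a partial map. -/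
def imageUlt (f : PartialMap P Y) : Ult Y where
  toFun V := P.ult (f.preimage V)
  map_sup' V W := by
    simp only [preimage]
    rw [Summand.preimage_sup, (Summand.gc_push_preimage f.supp).l_sup, map_sup]
  map_inf' V W := by
    simp only [preimage]
    rw [Summand.preimage_inf, Summand.push_inf, map_inf]
  map_top' := by
    simp only [preimage]
    rw [Summand.preimage_top, Summand.push_top]
    exact propext (iff_true_intro f.mem)
  map_bot' := by
    simp only [preimage]
    rw [Summand.preimage_bot, (Summand.gc_push_preimage f.supp).l_bot, map_bot]

/-- The codomain of a partial map, with the image ultrafilter. -/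
abbrev target (f : PartialMap P Y) : UF C := ⟨Y, f.imageUlt⟩

theorem continuous_target (f : PartialMap P Y) : Continuous (Q := f.target) f := fun _ => Iff.rfl

/-- A partial map as a morphism to its codomain with the image ultrafilter. -/
def toHom (f : PartialMap P Y) : P ⟶ f.target := Quotient.mk _ ⟨f, f.continuous_target⟩

/-- An everywhere defined morphism as a partial map. -/
def total (P : UF C) (a : P.pt ⟶ Z) : PartialMap P Z := (PartialMap.id P).postcomp a

theorem imageUlt_total (a : P.pt ⟶ Z) (V : Summand Z) :
    (total P a).imageUlt V ↔ P.ult (Summand.preimage a V) := by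
  have : (total P a).preimage V = Summand.preimage a V := Summand.ext_factors fun t => by
    rw [factors_preimage, Summand.factors_preimage]
    constructor
    · rintro ⟨k, rfl, h⟩
      exact Category.assoc k (Summand.ι ⊤) a ▸ h
    · intro h
      obtain ⟨k, rfl⟩ := Summand.factors_top t
      exact ⟨k, rfl, (Category.assoc k (Summand.ι ⊤) a).symm ▸ h⟩
  change P.ult _ ↔ _
  rw [this]

/-- The partial inverse of a coprojection. -/
def retraction (P : UF C) {A : C} (i : A ⟶ P.pt) (hi : IsCoprojection i)
    (h : P.ult (Summand.mk i hi)) : PartialMap P A :=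
  ⟨Summand.mk i hi, h, (Summand.exists_iso_mk i hi).choose.hom⟩

end PartialMap

/-- The germ underlying a morphism of ultrafilters. -/
def germ {P Q : UF C} : (P ⟶ Q) → Germ P Q.pt :=
  Quotient.map Subtype.val fun _ _ h => h

theorem germ_injective {P Q : UF C} : Function.Injective (germ : (P ⟶ Q) → Germ P Q.pt) := by
  rintro ⟨f⟩ ⟨g⟩ h
  exact Quotient.sound (Quotient.exact h : PartialMap.Eqv f.1 g.1)

theorem germ_comp_total {P Q : UF C} {Z : C} (f : P ⟶ Q) (a : Q.pt ⟶ Z) :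
    germ (f ≫ (PartialMap.total Q a).toHom) = (ultrahom P).map a (germ f) := by
  obtain ⟨f⟩ := f
  have h := PartialMap.postcomp_eqv (PartialMap.comp_id_eqv f.1 f.2) a
  refine (congrArg (Quotient.mk _) ?_).trans (Quotient.sound h)
  simp only [PartialMap.total, PartialMap.postcomp, PartialMap.comp, Category.assoc]

theorem germ_total_comp {P : UF C} {Y Z : C} (a : P.pt ⟶ Y) (b : Y ⟶ Z) :
    germ (PartialMap.total P (a ≫ b)).toHom =
      (ultrahom P).map b (germ (PartialMap.total P a).toHom) := by
  have h : PartialMap.total P (a ≫ b) = (PartialMap.total P a).postcomp b := by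
    simp only [PartialMap.total, PartialMap.postcomp, Category.assoc]
  exact congrArg (Quotient.mk _) h

/-- The ultrafilter on the codomain of a germ of continuous partial maps is determined by the
germ. -/
theorem ult_eq_of_germ_eq {P : UF C} {Y : C} {𝒱 𝒲 : Ult Y} (f : P ⟶ ⟨Y, 𝒱⟩) (g : P ⟶ ⟨Y, 𝒲⟩)
    (h : germ f = germ g) : 𝒱 = 𝒲 := by
  obtain ⟨f⟩ := f
  obtain ⟨g⟩ := g
  refine Ult.ext_of_le fun V hV => (g.2 V).2 ?_
  exact PartialMap.preimage_mem_of_eqv (Quotient.exact h) V ((f.2 V).1 hV)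

theorem sigma_eq_of_germ_eq (H : UF C ⥤ Type v) {P : UF C} {Y : C} {𝒱 𝒲 : Ult Y}
    (f : P ⟶ ⟨Y, 𝒱⟩) (g : P ⟶ ⟨Y, 𝒲⟩) (h : germ f = germ g) (x : H.obj P) :
    (⟨𝒱, H.map f x⟩ : Σ 𝒰 : Ult Y, H.obj ⟨Y, 𝒰⟩) = ⟨𝒲, H.map g x⟩ := by
  obtain rfl := ult_eq_of_germ_eq f g h
  rw [germ_injective h]

theorem germ_retraction_comp {P : UF C} {A : C} (i : A ⟶ P.pt) (hi : IsCoprojection i)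
    (h : P.ult (Summand.mk i hi)) :
    germ ((PartialMap.retraction P i hi h).toHom ≫ (PartialMap.total _ i).toHom) =
      germ (𝟙 P) := by
  refine (germ_comp_total _ _).trans ?_
  exact Quotient.sound (PartialMap.eqv_of (Summand.mk i hi) h (𝟙 _) (Summand.ofLE le_top)
    (Category.id_comp _) (Summand.ofLE_ι _) ((Category.id_comp _).trans
      ((Summand.exists_iso_mk i hi).choose_spec.trans (Summand.ofLE_ι le_top).symm)))

theorem germ_total_comp_retraction {Q : UF C} {X : C} (i : Q.pt ⟶ X) (hi : IsCoprojection i)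
    (h : (PartialMap.total Q i).imageUlt (Summand.mk i hi)) :
    germ ((PartialMap.total Q i).toHom ≫
      (PartialMap.retraction (PartialMap.total Q i).target i hi h).toHom) = germ (𝟙 Q) := by
  have := hi.mono
  obtain ⟨m, hm, hn⟩ := (PartialMap.total Q i).restrict_spec (Summand.mk i hi)
  refine Quotient.sound (PartialMap.eqv_of _ h (𝟙 _) m (Category.id_comp _) hm ?_)
  refine (Category.id_comp _).trans ((cancel_mono i).1 ?_)
  change ((PartialMap.total Q i).restrict (Summand.mk i hi) ≫
    (Summand.exists_iso_mk i hi).choose.hom) ≫ i = (m ≫ Summand.ι ⊤) ≫ i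
  rw [Category.assoc, (Summand.exists_iso_mk i hi).choose_spec, hn]
  exact (Category.assoc _ _ _).symm

/-- The action of a morphism of `C` on the elements of `H` at ultrafilters on its domain. -/
def sumMap (H : UF C ⥤ Type v) {X Y : C} (a : X ⟶ Y) (s : Σ 𝒰 : Ult X, H.obj ⟨X, 𝒰⟩) :
    Σ 𝒱 : Ult Y, H.obj ⟨Y, 𝒱⟩ :=
  ⟨_, H.map (PartialMap.total ⟨X, s.1⟩ a).toHom s.2⟩

theorem sumMap_id (H : UF C ⥤ Type v) {X : C} (s : Σ 𝒰 : Ult X, H.obj ⟨X, 𝒰⟩) :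
    sumMap H (𝟙 X) s = s := by
  have := sigma_eq_of_germ_eq H (PartialMap.total ⟨X, s.1⟩ (𝟙 X)).toHom (𝟙 _)
    (congrArg (Quotient.mk _) (by simp [PartialMap.total, PartialMap.postcomp])) s.2
  rw [H.map_id] at this
  exact this

theorem sumMap_mk (H : UF C ⥤ Type v) {P Q : UF C} (f : P ⟶ Q) {Z : C} (a : Q.pt ⟶ Z) {R : Ult Z}
    (g : P ⟶ ⟨Z, R⟩) (h : germ g = (ultrahom P).map a (germ f)) (x : H.obj P) :
    sumMap H a ⟨Q.ult, H.map f x⟩ = ⟨R, H.map g x⟩ := by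
  have := sigma_eq_of_germ_eq H (f ≫ (PartialMap.total Q a).toHom) g
    ((germ_comp_total f a).trans h.symm) x
  rw [H.map_comp] at this
  exact this

theorem sumMap_comp (H : UF C ⥤ Type v) {X Y Z : C} (a : X ⟶ Y) (b : Y ⟶ Z)
    (s : Σ 𝒰 : Ult X, H.obj ⟨X, 𝒰⟩) : sumMap H (a ≫ b) s = sumMap H b (sumMap H a s) :=
  (sumMap_mk H (PartialMap.total ⟨X, s.1⟩ a).toHom b (PartialMap.total ⟨X, s.1⟩ (a ≫ b)).toHom
    (germ_total_comp (P := ⟨X, s.1⟩) a b) s.2).symm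

/-- The functor `X ↦ ∑ 𝒰 : βX, H(X, 𝒰)` on `C` associated to a functor `H` on ultrafilters. -/
def sumObj (H : UF C ⥤ Type v) : C ⥤ Type v where
  obj X := Σ 𝒰 : Ult X, H.obj ⟨X, 𝒰⟩
  map a := ↾(sumMap H a)
  map_id _ := ConcreteCategory.hom_ext _ _ (sumMap_id H)
  map_comp a b := ConcreteCategory.hom_ext _ _ (sumMap_comp H a b)

variable (H : UF C ⥤ Type v)

/-- The element of `∑ 𝒰 : βX, H(X, 𝒰)` given by an element of `H(X, 𝒰)`. -/
abbrev sumMk {P : UF C} (x : H.obj P) : (sumObj H).obj P.pt := ⟨P.ult, x⟩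

section Coprojection

variable {A X : C} (i : A ⟶ X) (hi : IsCoprojection i)

theorem mem_of_mem_range {s : (sumObj H).obj X} (hs : s ∈ Set.range ((sumObj H).map i)) :
    s.1 (Summand.mk i hi) := by
  obtain ⟨s, rfl⟩ := hs
  refine (PartialMap.imageUlt_total (P := ⟨A, s.1⟩) i _).2 ?_
  have : Summand.preimage i (Summand.mk i hi) = ⊤ := Summand.ext_factors fun t => by
    rw [Summand.factors_preimage, Summand.factors_mk]
    exact iff_of_true ⟨t, rfl⟩ (Summand.factors_top t)
  rw [this]
  exact UF.mem_top ⟨A, s.1⟩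

/-- The partial inverse of the action of a coprojection. -/
def sumRetraction (s : (sumObj H).obj X) (hs : s.1 (Summand.mk i hi)) : (sumObj H).obj A :=
  sumMk H (H.map (PartialMap.retraction ⟨X, s.1⟩ i hi hs).toHom s.2)

theorem map_sumRetraction (s : (sumObj H).obj X) (hs : s.1 (Summand.mk i hi)) :
    (sumObj H).map i (sumRetraction H i hi s hs) = s := by
  refine (sumMap_mk H (PartialMap.retraction ⟨X, s.1⟩ i hi hs).toHom i (R := s.1) (𝟙 _) ?_
    s.2).trans ?_
  · exact (germ_retraction_comp (P := ⟨X, s.1⟩) i hi hs).symm.trans (germ_comp_total _ _)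
  · rw [H.map_id]
    rfl

theorem sumRetraction_map (s : (sumObj H).obj A) (hs) :
    sumRetraction H i hi ((sumObj H).map i s) hs = s := by
  have := sigma_eq_of_germ_eq H _ _ (germ_total_comp_retraction (Q := ⟨A, s.1⟩) i hi hs) s.2
  rw [H.map_id, H.map_comp] at this
  exact this

theorem mem_range_iff (s : (sumObj H).obj X) :
    s ∈ Set.range ((sumObj H).map i) ↔ s.1 (Summand.mk i hi) :=
  ⟨mem_of_mem_range H i hi, fun hs => ⟨_, map_sumRetraction H i hi s hs⟩⟩

end Coprojection

theorem sumObj_map_injective {A X : C} (i : A ⟶ X) (hi : IsCoprojection i) :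
    Function.Injective ((sumObj H).map i) := by
  intro s t h
  rw [← sumRetraction_map H i hi s (mem_of_mem_range H i hi ⟨s, rfl⟩),
    ← sumRetraction_map H i hi t (mem_of_mem_range H i hi ⟨t, rfl⟩)]
  simp only [h]

theorem isEmpty_ult {X : C} (h : IsInitial X) : IsEmpty (Ult X) := by
  refine ⟨fun 𝒰 => ?_⟩
  have : (⊤ : Summand X) = ⊥ := Summand.ext_factors fun t => by
    rw [Summand.factors_bot]
    refine iff_of_true (Summand.factors_top t) ?_
    have := h.isIso_to t
    exact ⟨h.ofIso (asIso t).symm⟩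
  have h' : 𝒰 ⊤ = 𝒰 ⊥ := by rw [this]
  rw [map_top, map_bot] at h'
  exact h'.mp trivial

instance preservesFiniteCoproducts_sumObj : PreservesFiniteCoproducts (sumObj H) := by
  have h₁ : PreservesColimitsOfShape (Discrete WalkingPair) (sumObj H) := by
    refine ⟨fun {K} => ?_⟩
    have : PreservesColimit (pair (K.obj ⟨.left⟩) (K.obj ⟨.right⟩)) (sumObj H) := by
      refine ⟨fun {c} hc => ?_⟩
      obtain ⟨hc⟩ : Nonempty (IsColimit (BinaryCofan.mk (BinaryCofan.inl c)
        (BinaryCofan.inr c))) := ⟨hc.ofIsoColimit (isoBinaryCofanMk c)⟩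
      have hi : IsCoprojection (BinaryCofan.inl c) := ⟨_, _, ⟨hc⟩⟩
      have hj : IsCoprojection (BinaryCofan.inr c) := isCoprojection_symm hc
      have hcompl := Summand.isCompl_mk hc hi hj
      obtain ⟨k⟩ := (Types.binaryCofan_isColimit_iff (BinaryCofan.mk
        ((sumObj H).map (BinaryCofan.inl c)) ((sumObj H).map (BinaryCofan.inr c)))).2
        ⟨sumObj_map_injective H _ hi, sumObj_map_injective H _ hj, by
          refine isCompl_iff.2 ⟨Set.disjoint_left.2 fun s hs ht => ?_,
            codisjoint_iff_le_sup.2 fun s _ => ?_⟩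
          · have hs := (mem_range_iff H _ hi s).1 hs
            have ht := (mem_range_iff H _ hj s).1 ht
            rw [← hcompl.compl_eq, Ult.compl_iff] at ht
            exact ht hs
          · by_cases hs : s.1 (Summand.mk _ hi)
            · exact Or.inl ((mem_range_iff H _ hi s).2 hs)
            · rw [← Ult.compl_iff, hcompl.compl_eq] at hs
              exact Or.inr ((mem_range_iff H _ hj s).2 hs)⟩
      exact ⟨((isColimitMapCoconeBinaryCofanEquiv _ _ _).symm k).ofIsoColimit
        ((Cocone.functoriality _ (sumObj H)).mapIso (isoBinaryCofanMk c).symm)⟩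
    exact preservesColimit_of_iso_diagram _ (diagramIsoPair K).symm
  have h₂ : PreservesColimitsOfShape (Discrete PEmpty.{1}) (sumObj H) := by
    have : PreservesColimit (Functor.empty.{0} C) (sumObj H) := by
      refine preservesInitial_of_iso _ ?_
      refine initialIsInitial.uniqueUpToIso ((Types.initial_iff_empty _).2 ?_).some
      exact ⟨fun s => (isEmpty_ult initialIsInitial).false s.1⟩
    exact preservesColimitsOfShape_pempty_of_preservesInitial _
  exact ⟨fun n => PreservesFiniteCoproducts.of_preserves_binary_and_initial _ _⟩

/-- The functor sending `H` to `X ↦ ∑ 𝒰 : βX, H(X, 𝒰)`. -/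
def sumFunctor (C : Type u) [Category.{v} C] [FinitaryExtensive C] :
    (UF C ⥤ Type v) ⥤ (FC C).FullSubcategory where
  obj H := ⟨sumObj H, preservesFiniteCoproducts_sumObj H⟩
  map {H K} α := ObjectProperty.homMk
    { app := fun X => ↾(fun s => ⟨s.1, α.app _ s.2⟩)
      naturality := fun X Y a => by
        refine ConcreteCategory.hom_ext _ _ fun ⟨𝒰, x⟩ => ?_
        exact congrArg (Sigma.mk _) (NatTrans.naturality_apply α _ x) }
  map_id H := rfl
  map_comp α β := rfl

variable {H} {K : UF C ⥤ Type v}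

theorem fst_app (β : sumObj H ⟶ sumObj K) {X : C} (s : (sumObj H).obj X) :
    (β.app X s).1 = s.1 := by
  refine (Ult.ext_of_le fun U hU => ?_).symm
  rw [← U.mk_ι] at hU ⊢
  refine (mem_range_iff K U.ι U.isCoprojection _).1 ?_
  obtain ⟨t, rfl⟩ := (mem_range_iff H U.ι U.isCoprojection _).2 hU
  exact ⟨β.app _ t, (NatTrans.naturality_apply β _ _).symm⟩

theorem exists_app_eq (β : sumObj H ⟶ sumObj K) (P : UF C) (x : H.obj P) :
    ∃ y : K.obj P, β.app P.pt (sumMk H x) = sumMk K y := by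
  have h := fst_app β (sumMk H x)
  generalize β.app P.pt (sumMk H x) = s at h
  obtain ⟨𝒰, y⟩ := s
  obtain rfl : 𝒰 = P.ult := h
  exact ⟨y, rfl⟩

theorem sumMk_injective {P : UF C} {x y : H.obj P} (h : sumMk H x = sumMk H y) : x = y :=
  eq_of_heq (Sigma.mk.inj h).2

theorem naturality_of_app_eq (β : sumObj H ⟶ sumObj K) {P Q : UF C} (f : P ⟶ Q) {x : H.obj P}
    {y : K.obj P} (h : β.app P.pt (sumMk H x) = sumMk K y) :
    β.app Q.pt (sumMk H (H.map f x)) = sumMk K (K.map f y) := by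
  obtain ⟨f⟩ := f
  have hi := f.1.supp.isCoprojection
  have hs : P.ult (Summand.mk f.1.supp.ι hi) := by rw [Summand.mk_ι]; exact f.1.mem
  let r := (PartialMap.retraction P f.1.supp.ι hi hs).toHom
  have hr : ∀ (L : UF C ⥤ Type v) (z : L.obj P), (sumObj L).map f.1.hom (sumMk L (L.map r z)) =
      sumMk L (L.map (Quotient.mk _ f) z) := fun L z =>
    sumMap_mk L r f.1.hom (Quotient.mk _ f) (Quotient.sound (PartialMap.eqv_of _ hs
      (Summand.exists_iso_mk f.1.supp.ι hi).choose.hom (𝟙 _)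
      (Summand.exists_iso_mk f.1.supp.ι hi).choose_spec (Category.id_comp _)
      (Category.id_comp _).symm)) z
  have hβ : β.app _ (sumMk H (H.map r x)) = sumMk K (K.map r y) := by
    refine sumObj_map_injective K f.1.supp.ι hi ?_
    refine (NatTrans.naturality_apply β _ _).symm.trans ?_
    refine (congrArg _ (map_sumRetraction H f.1.supp.ι hi (sumMk H x) hs)).trans ?_
    exact h.trans (map_sumRetraction K f.1.supp.ι hi (sumMk K y) hs).symm
  refine (congrArg _ (hr H x).symm).trans ((NatTrans.naturality_apply β _ _).trans ?_)
  exact (congrArg _ hβ).trans (hr K y)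

instance : (sumFunctor C).Faithful where
  map_injective {H K α β} h := by
    ext P x
    have h' := congrArg (fun γ => γ.hom.app P.pt (sumMk H x)) h
    exact sumMk_injective h'

instance : (sumFunctor C).Full where
  map_surjective {H K} β := by
    choose φ hφ using exists_app_eq β.hom
    refine ⟨{ app := fun P => ↾(φ P), naturality := fun P Q f => ?_ }, ?_⟩
    · ext x
      exact sumMk_injective ((hφ _ _).symm.trans (naturality_of_app_eq β.hom f (hφ P x)))
    · ext X s
      exact (hφ ⟨X, s.1⟩ s.2).symm

section ElementType

variable (F : C ⥤ Type v) {X Y : C}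

/-- The element `x` of `F(X)` comes from the summand `U` of `X`. -/
def InSummand (x : F.obj X) (U : Summand X) : Prop := x ∈ Set.range (F.map U.ι)

variable {F}

theorem InSummand.of_factors {T : C} {t : T ⟶ X} {U : Summand X} (h : U.Factors t)
    (y : F.obj T) : InSummand F (F.map t y) U := by
  obtain ⟨k, rfl⟩ := h
  exact ⟨F.map k y, (F.map_comp_apply k U.ι y).symm⟩

theorem InSummand.mono {x : F.obj X} {U V : Summand X} (h : U ≤ V) (hx : InSummand F x U) :
    InSummand F x V := by
  obtain ⟨y, rfl⟩ := hx
  exact InSummand.of_factors (Summand.le_iff.1 h) y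

variable [PreservesFiniteCoproducts F]

theorem isCompl_range_map (U : Summand X) :
    Function.Injective (F.map U.ι) ∧ Function.Injective (F.map Uᶜ.ι) ∧
      IsCompl (Set.range (F.map U.ι)) (Set.range (F.map Uᶜ.ι)) :=
  (Types.binaryCofan_isColimit_iff (BinaryCofan.mk (F.map U.ι) (F.map Uᶜ.ι))).1
    ⟨mapIsColimitOfPreservesOfIsColimit F _ _ U.isColimit_compl.some⟩

theorem map_ι_injective (U : Summand X) : Function.Injective (F.map U.ι) :=
  (isCompl_range_map U).1

theorem inSummand_compl {x : F.obj X} {U : Summand X} :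
    InSummand F x Uᶜ ↔ ¬ InSummand F x U := by
  have h := (isCompl_range_map (F := F) U).2.2
  exact (Set.ext_iff.1 h.compl_eq x).symm

theorem inSummand_map (a : X ⟶ Y) (x : F.obj X) (V : Summand Y) :
    InSummand F (F.map a x) V ↔ InSummand F x (Summand.preimage a V) := by
  have h : ∀ V : Summand Y, InSummand F x (Summand.preimage a V) → InSummand F (F.map a x) V := by
    rintro V ⟨y, rfl⟩
    have := InSummand.of_factors (F := F)
      ((Summand.factors_preimage a V _).1 (Summand.preimage a V).factors_ι) y
    rwa [F.map_comp_apply] at this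
  refine ⟨fun hV => by_contra fun hn => ?_, h V⟩
  rw [← inSummand_compl, ← Summand.preimage_compl] at hn
  exact inSummand_compl.1 (h _ hn) hV

theorem inSummand_push (S : Summand X) (W : Summand S.dom) (y : F.obj S.dom) :
    InSummand F (F.map S.ι y) (S.push W) ↔ InSummand F y W := by
  constructor
  · rintro ⟨p, hp⟩
    obtain ⟨k, hk, hW⟩ := (Summand.factors_push _ _ _).1 (S.push W).factors_ι
    rw [← hk, F.map_comp_apply] at hp
    rw [← map_ι_injective S hp]
    exact InSummand.of_factors hW p
  · rintro ⟨p, rfl⟩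
    rw [← F.map_comp_apply]
    exact InSummand.of_factors ((Summand.factors_push _ _ _).2 ⟨W.ι, rfl, W.factors_ι⟩) p

variable (F) in
/-- The ultrafilter of all summands of `X` from which an element of `F(X)` comes. -/
def elementUlt (x : F.obj X) : Ult X :=
  Ult.ofPrime (InSummand F x)
    (by
      have := InSummand.of_factors (F := F) (Summand.factors_top (𝟙 X)) x
      rwa [F.map_id_apply] at this)
    (fun U V => by
      refine ⟨fun h => ⟨h.mono inf_le_left, h.mono inf_le_right⟩, ?_⟩
      rintro ⟨⟨y, rfl⟩, hV⟩
      exact (inSummand_push U _ y).2 ((inSummand_map _ _ _).1 hV))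
    (fun _ => inSummand_compl)

/-- The value of a partial map at an element. -/
def PartialMap.eval {P : UF C} (f : PartialMap P Y)
    (x : {x : F.obj P.pt // elementUlt F x = P.ult}) : F.obj Y :=
  F.map f.hom (Exists.choose (show InSummand F x.1 f.supp from
    (congrArg (fun 𝒰 : Ult P.pt => 𝒰 f.supp) x.2).mpr f.mem))

variable {P Q : UF C} (x : {x : F.obj P.pt // elementUlt F x = P.ult})

theorem inSummand_of_mem {U : Summand P.pt} (h : P.ult U) : InSummand F x.1 U :=
  (congrArg (fun 𝒰 : Ult P.pt => 𝒰 U) x.2).mpr h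

theorem PartialMap.eval_eq (f : PartialMap P Y) {y : F.obj f.supp.dom}
    (h : F.map f.supp.ι y = x.1) : f.eval x = F.map f.hom y := by
  have h' := Exists.choose_spec (show InSummand F x.1 f.supp from inSummand_of_mem x f.mem)
  exact congrArg _ (map_ι_injective _ (h'.trans h.symm))

theorem PartialMap.eval_eq_of_eqv {f g : PartialMap P Y} (h : Eqv f g) : f.eval x = g.eval x := by
  obtain ⟨W, hW, h₁, h₂, h⟩ := h
  obtain ⟨w, hw⟩ := inSummand_of_mem x hW
  rw [f.eval_eq x (y := F.map (Summand.ofLE h₁) w), g.eval_eq x (y := F.map (Summand.ofLE h₂) w),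
    ← F.map_comp_apply, h, F.map_comp_apply]
  · rw [← F.map_comp_apply, Summand.ofLE_ι, hw]
  · rw [← F.map_comp_apply, Summand.ofLE_ι, hw]

theorem PartialMap.elementUlt_eval (f : PartialMap P Y) :
    elementUlt F (f.eval x) = f.imageUlt := by
  obtain ⟨y, hy⟩ := inSummand_of_mem x f.mem
  rw [f.eval_eq x hy]
  ext V
  refine (inSummand_map f.hom y V).trans ((inSummand_push f.supp _ y).symm.trans ?_)
  rw [hy]
  exact iff_of_eq (congrArg (fun 𝒰 : Ult P.pt => 𝒰 _) x.2)

theorem PartialMap.eval_total (a : P.pt ⟶ Y) : (total P a).eval x = F.map a x.1 := by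
  obtain ⟨y, hy⟩ := inSummand_of_mem x P.mem_top
  refine ((total P a).eval_eq x hy).trans ?_
  rw [← hy, ← F.map_comp_apply]
  rfl

theorem PartialMap.elementUlt_eval_of_continuous (f : PartialMap P Q.pt) (hf : f.Continuous) :
    elementUlt F (f.eval x) = Q.ult := by
  rw [f.elementUlt_eval x]
  ext V
  exact (hf V).symm

theorem PartialMap.eval_comp (f : PartialMap P Q.pt) (hf : f.Continuous) (g : PartialMap Q Y) :
    (f.comp hf g).eval x = g.eval ⟨f.eval x, f.elementUlt_eval_of_continuous x hf⟩ := by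
  obtain ⟨p, hp⟩ : InSummand F x.1 (f.preimage g.supp) := inSummand_of_mem x (f.comp hf g).mem
  obtain ⟨k, hk, hl⟩ := f.restrict_spec g.supp
  rw [(f.comp hf g).eval_eq x hp, g.eval_eq _ (y := F.map (f.restrict g.supp) p)]
  · exact F.map_comp_apply _ _ p
  · change F.map g.supp.ι (F.map (f.restrict g.supp) p) = f.eval x
    rw [f.eval_eq x (y := F.map k p), ← F.map_comp_apply, hl, F.map_comp_apply]
    rw [← F.map_comp_apply, hk, hp]

variable (F) in
/-- The functor sending `(X, 𝒰)` to the set of elements of `F(X)` with ultrafilter `𝒰`. -/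
def fibreFunctor : UF C ⥤ Type v where
  obj P := {x : F.obj P.pt // elementUlt F x = P.ult}
  map {P Q} := Quotient.lift
    (fun f : {f : PartialMap P Q.pt // f.Continuous} =>
      ↾(fun x : {x : F.obj P.pt // elementUlt F x = P.ult} =>
        (⟨f.1.eval x, f.1.elementUlt_eval_of_continuous x f.2⟩ :
          {x : F.obj Q.pt // elementUlt F x = Q.ult})))
    (fun _ _ h => ConcreteCategory.hom_ext _ _ fun x => Subtype.ext
      (PartialMap.eval_eq_of_eqv x h))
  map_id P := ConcreteCategory.hom_ext _ _ fun x => Subtype.ext (by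
    obtain ⟨y, hy⟩ := inSummand_of_mem x P.mem_top
    exact ((PartialMap.id P).eval_eq x hy).trans hy)
  map_comp := by
    rintro P Q R ⟨f⟩ ⟨g⟩
    exact ConcreteCategory.hom_ext _ _ fun x => Subtype.ext (PartialMap.eval_comp x f.1 f.2 g.1)

variable (F) in
/-- Every element belongs to the fibre at its ultrafilter. -/
def sumFibre : sumObj (fibreFunctor F) ⟶ F where
  app X := ↾(fun s : Σ 𝒰 : Ult X, {x : F.obj X // elementUlt F x = 𝒰} => s.2.1)
  naturality X _ a := ConcreteCategory.hom_ext _ _ fun s =>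
    PartialMap.eval_total (P := ⟨X, s.1⟩) s.2 a

instance : IsIso (sumFibre F) := by
  have (X : C) : IsIso ((sumFibre F).app X) :=
    (isIso_iff_bijective _).2 (Equiv.sigmaFiberEquiv (elementUlt F (X := X))).bijective
  exact NatIso.isIso_of_isIso_app _

end ElementType

instance : (sumFunctor C).EssSurj where
  mem_essImage F := by
    have : PreservesFiniteCoproducts F.obj := F.property
    exact ⟨fibreFunctor F.obj, ⟨ObjectProperty.isoMk _ (asIso (sumFibre F.obj) : sumObj _ ≅ F.obj)⟩⟩

instance : (sumFunctor C).IsEquivalence where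

/-- The germ of a morphism, as a transformation from the functor corresponding to a
representable functor to the ultrahom functor. -/
def sumCoyoneda (P : (UF C)ᵒᵖ) : sumObj (coyoneda.obj P) ⟶ ultrahom P.unop where
  app Y := ↾(fun s : Σ 𝒱 : Ult Y, (P.unop ⟶ ⟨Y, 𝒱⟩) => germ s.2)
  naturality X _ a := ConcreteCategory.hom_ext _ _ fun s =>
    germ_comp_total (Q := ⟨X, s.1⟩) s.2 a

instance (P : (UF C)ᵒᵖ) : IsIso (sumCoyoneda P) := by
  have (X : C) : IsIso ((sumCoyoneda P).app X) := by
    refine (isIso_iff_bijective _).2 ⟨?_, ?_⟩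
    · rintro ⟨𝒰, f⟩ ⟨𝒱, g⟩ h
      obtain rfl := ult_eq_of_germ_eq f g h
      exact congrArg (Sigma.mk 𝒰) (germ_injective h)
    · rintro ⟨f⟩
      exact ⟨⟨f.imageUlt, f.toHom⟩, rfl⟩
  exact NatIso.isIso_of_isIso_app _

/-- Representable functors on ultrafilters correspond to ultrahom functors. -/
def sumCoyonedaIso (C : Type u) [Category.{v} C] [FinitaryExtensive C] :
    coyoneda ⋙ sumFunctor C ⋙ (FC C).ι ≅ ultrahomFunctor C :=
  NatIso.ofComponents (fun P => (asIso (sumCoyoneda P) : sumObj (coyoneda.obj P) ≅ _)) (by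
    rintro P Q ⟨⟨a⟩⟩
    ext Y ⟨𝒱, ⟨f⟩⟩
    rfl)

/-- The ultrahom functor is the colimit of the hom-functors of the members of the ultrafilter. -/
def isColimitUltrahomCocone (P : UF C) : IsColimit (ultrahomCocone P) where
  desc s :=
    { app := fun Y => ↾(fun g : Germ P Y => Quotient.lift
        (fun f : PartialMap P Y => (s.ι.app (op ⟨f.supp, f.mem⟩)).app Y f.hom) (by
          rintro f g ⟨W, hW, h₁, h₂, h⟩
          have key : ∀ {U : Summand P.pt} (hU : P.ult U) (hWU : W ≤ U) (a : U.dom ⟶ Y),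
              (s.ι.app (op ⟨U, hU⟩)).app Y a =
                (s.ι.app (op ⟨W, hW⟩)).app Y (Summand.ofLE hWU ≫ a) := fun hU hWU a =>
            (ConcreteCategory.congr_hom (NatTrans.congr_app
              (s.w (homOfLE hWU : (⟨W, hW⟩ : P.Members) ⟶ ⟨_, hU⟩).op) Y) a).symm
          exact (key f.mem h₁ f.hom).trans ((congrArg _ h).trans (key g.mem h₂ g.hom).symm)) g)
      naturality := fun Y Z a => by
        refine ConcreteCategory.hom_ext _ _ ?_
        rintro ⟨f⟩
        exact NatTrans.naturality_apply (s.ι.app (op ⟨f.supp, f.mem⟩)) a f.hom }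
  fac s U := rfl
  uniq s m h := by
    ext Y ⟨f⟩
    exact ConcreteCategory.congr_hom (NatTrans.congr_app (h (op ⟨f.supp, f.mem⟩)) Y) f.hom

end

end ExtensiveCat

open ExtensiveCat in
theorem theorem6 (C : Type u) [Category.{v} C] [FinitaryExtensive C] :
    ∃ e : (FC C).FullSubcategory ≌ (UF C ⥤ Type v),
      Nonempty (coyoneda ⋙ e.inverse ⋙ (FC C).ι ≅ ultrahomFunctor C) ∧
      ∀ P : UF C, Nonempty (IsColimit (ultrahomCocone P)) :=
  ⟨(sumFunctor C).asEquivalence.symm, ⟨sumCoyonedaIso C⟩, fun P => ⟨isColimitUltrahomCocone P⟩⟩
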